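/- Let $V$ be a reflexive separable (real) Banach space with dual $V^*$ and let $[0,T]$ be a time interval. Call $\Psi:V\to[0,+\infty)$ an admissible dissipation potential if $\Psi$ is lower semicontinuous and convex, $\Psi(0)=0$, $\Psi(v)/\|v\|\to+\infty$ as $\|v\|\to+\infty$, $\Psi^*(\xi)/\|\xi\|_*\to+\infty$ as $\|\xi\|_*\to+\infty$ (where $\Psi^*$ is the Fenchel–Moreau conjugate), and $\Psi^*(w_1)=\Psi^*(w_2)$ whenever $w_1,w_2\in\partial\Psi(v)$ for some $v\in V$, with $\partial\Psi$ the subdifferential of convex analysis. Let $\emptyset\ne D\subset V$ and let $\mathcal E:[0,T]\times V\to(-\infty,+\infty]$ have domain $\{\mathcal E<+\infty\}=[0,T]\times D$, with $u\mapsto\mathcal E_t(u)$ lower semicontinuous for every $t\in[0,T]$ and $\mathcal E_t(u)\ge C_0$ for all $(t,u)\in[0,T]\times D$ and some constant $C_0>0$. Let $\mathrm F:[0,T]\times D\rightrightarrows V^*$ be a multivalued map whose graph is a Borel subset of $[0,T]\times V\times V^*$. Let $(\Psi_w)_{w\in S}$, $S\subset V$, be a family of admissible dissipation potentials (e.g.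 $S=D$ or $S=V$). Suppose that: (i) $\partial\mathcal E_t(u)\subset\mathrm F_t(u)$ for every $(t,u)\in[0,T]\times D$, where $\partial\mathcal E_t(u)$ is the Fréchet subdifferential, i.e. the set of $\xi\in V^*$ with $\mathcal E_t(v)-\mathcal E_t(u)-\langle\xi,v-u\rangle\ge o(\|v-u\|)$ as $v\to u$ in $V$; (ii) $(\mathcal E,\mathrm F)$ is weakly closed: for all $t\in[0,T]$ and all sequences $u_n\in D$, $\xi_n\in\mathrm F_t(u_n)$ with $u_n\to u$ in $V$, $\xi_n\rightharpoonup\xi$ weakly in $V^*$ and $\mathcal E_t(u_n)\to\mathscr E$ in $\mathbb R$, one has $u\in D$, $\xi\in\mathrm F_t(u)$ and $\mathscr E=\mathcal E_t(u)$. Then the variational sum rule holds: for all $t\in[0,T]$, $u_o\in S$, $\tau>0$ and every minimizer $\bar u\in V$ of $u\mapsto\mathcal E_t(u)+\tau\Psi_{u_o}\big((u-u_o)/\tau\big)$ over $V$, there exists $\xi\in\mathrm F_t(\bar u)$ with $-\xi\in\partial\Psi_{u_o}\big((\bar u-u_o)/\tau\big)$. -/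

import Mathlib

open Set Filter Topology MeasureTheory

noncomputable section

/-- A real normed space is reflexive if the canonical embedding into its bidual is onto. -/
def IsReflexiveSpace (V : Type*) [NormedAddCommGroup V] [NormedSpace ℝ V] : Prop :=
  Function.Surjective (NormedSpace.inclusionInDoubleDual ℝ V)

/-- Subdifferential, in the sense of convex analysis, of a finite function `Ψ` at `v`. -/
def convexSubdiff {V : Type*} [NormedAddCommGroup V] [NormedSpace ℝ V]
    (Ψ : V → ℝ) (v : V) : Set (StrongDual ℝ V) :=
  {w | ∀ z : V, Ψ v + w (z - v) ≤ Ψ z}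

/-- Fenchel-Moreau conjugate `Ψ*(ξ) = sup_v (⟨ξ, v⟩ - Ψ(v))`, with values in `[-∞, +∞]`. -/
def fenchelConj {V : Type*} [NormedAddCommGroup V] [NormedSpace ℝ V]
    (Ψ : V → ℝ) (ξ : StrongDual ℝ V) : EReal :=
  ⨆ v : V, ((ξ v - Ψ v : ℝ) : EReal)

/-- Admissible dissipation potentials `Ψ : V → [0, +∞)`. -/
structure IsAdmissiblePotential {V : Type*} [NormedAddCommGroup V] [NormedSpace ℝ V]
    (Ψ : V → ℝ) : Prop where
  nonneg : ∀ v, 0 ≤ Ψ v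
  lsc : LowerSemicontinuous Ψ
  convex : ConvexOn ℝ univ Ψ
  map_zero : Ψ 0 = 0
  superlinear : Tendsto (fun v : V => Ψ v / ‖v‖) (Bornology.cobounded V) atTop
  conj_superlinear :
    Tendsto (fun ξ : StrongDual ℝ V => fenchelConj Ψ ξ / ((‖ξ‖ : ℝ) : EReal))
      (Bornology.cobounded (StrongDual ℝ V)) (𝓝 ⊤)
  conj_eq : ∀ v : V, ∀ w₁ ∈ convexSubdiff Ψ v, ∀ w₂ ∈ convexSubdiff Ψ v,
    fenchelConj Ψ w₁ = fenchelConj Ψ w₂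

/-- Fréchet subdifferential of an extended-real-valued function `f` at a point `u` where `f` is
finite: `f v - f u - ⟨ξ, v - u⟩ ≥ o(‖v - u‖)` as `v → u`. It is empty where `f` is infinite. -/
def frechetSubdiff {V : Type*} [NormedAddCommGroup V] [NormedSpace ℝ V]
    (f : V → EReal) (u : V) : Set (StrongDual ℝ V) :=
  {ξ | f u ≠ ⊤ ∧ f u ≠ ⊥ ∧ ∀ ε : ℝ, 0 < ε → ∀ᶠ v in 𝓝 u,
    f u + ((ξ (v - u) - ε * ‖v - u‖ : ℝ) : EReal) ≤ f v}

/-- Graph of the multivalued map `F : [0,T] × D ⇉ V*`. -/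
def multiGraph {V : Type*} [NormedAddCommGroup V] [NormedSpace ℝ V]
    (T : ℝ) (D : Set V) (F : ℝ → V → Set (StrongDual ℝ V)) :
    Set (ℝ × V × StrongDual ℝ V) :=
  {p | p.1 ∈ Icc 0 T ∧ p.2.1 ∈ D ∧ p.2.2 ∈ F p.1 p.2.1}

/-- Domain of the multivalued map `F : [0,T] × D ⇉ V*`. -/
def multiDom {V : Type*} [NormedAddCommGroup V] [NormedSpace ℝ V]
    (T : ℝ) (D : Set V) (F : ℝ → V → Set (StrongDual ℝ V)) : Set (ℝ × V) :=
  {p | p.1 ∈ Icc 0 T ∧ p.2 ∈ D ∧ (F p.1 p.2).Nonempty}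

/-- Basic conditions on the energy `E : [0,T] × V → (-∞, +∞]` with domain `[0,T] × D` and on the
multivalued map `F`. Only the values of `E` and `F` at times in `[0,T]` matter. -/
structure IsEnergy {V : Type*} [NormedAddCommGroup V] [NormedSpace ℝ V]
    (T : ℝ) (D : Set V) (E : ℝ → V → EReal) (F : ℝ → V → Set (StrongDual ℝ V)) : Prop where
  dom_nonempty : D.Nonempty
  dom_eq : ∀ t ∈ Icc 0 T, ∀ u : V, E t u ≠ ⊤ ↔ u ∈ D
  lsc : ∀ t ∈ Icc 0 T, LowerSemicontinuous (E t)
  bounded_below : ∃ C₀ : ℝ, 0 < C₀ ∧ ∀ t ∈ Icc 0 T, ∀ u ∈ D, (C₀ : EReal) ≤ E t u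
  borel_graph : MeasurableSet[borel (ℝ × V × StrongDual ℝ V)] (multiGraph T D F)

/-- Weak closedness of the pair `(E, F)`: strong convergence in `V`, weak convergence in `V*` and
convergence of the (real) energies. -/
def IsWeaklyClosedPair {V : Type*} [NormedAddCommGroup V] [NormedSpace ℝ V]
    (T : ℝ) (D : Set V) (E : ℝ → V → EReal) (F : ℝ → V → Set (StrongDual ℝ V)) : Prop :=
  ∀ t ∈ Icc 0 T, ∀ (us : ℕ → V) (ξs : ℕ → StrongDual ℝ V) (es : ℕ → ℝ)
    (u : V) (ξ : StrongDual ℝ V) (e : ℝ),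
    (∀ n, (t, us n, ξs n) ∈ multiGraph T D F) →
    (∀ n, (es n : EReal) = E t (us n)) →
    Tendsto us atTop (𝓝 u) →
    Tendsto (fun n => toWeakSpace ℝ (StrongDual ℝ V) (ξs n)) atTop
      (𝓝 (toWeakSpace ℝ (StrongDual ℝ V) ξ)) →
    Tendsto es atTop (𝓝 e) →
    (t, u) ∈ multiDom T D F ∧ ξ ∈ F t u ∧ (e : EReal) = E t u

end

/-! Write g(u) = τΨ((u - u₀)/τ). At a minimizer of E_t + g an exact Fréchet sum rule may fail, but
an approximate one holds (`exists_approximate_subgradients`): arbitrarily close to the minimizer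
there are u, v with ξ in the Fréchet subdifferential of E_t at u, η in ∂g(v) and ξ + η small. To get
it, the variables are doubled: E_t(u) + g(v) + N h(u - v), with h Fréchet differentiable and
comparable to ‖·‖², is almost minimal on the diagonal. `smooth_variational_principle` turns this
into an exact minimum of a smoothly perturbed function; there the derivatives of the penalty in u
and v cancel, and only the small derivative of the perturbation remains.

The norm itself need not be differentiable, so h is constructed (`exists_smooth_quadratic`) as the
conjugate of a weak* lower semicontinuous function k on the dual (`dualEnergy`). Local uniform
convexity of k makes the maximizer J x in the conjugate depend norm-continuously on x, so that J is
the Fréchet derivative of h.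

In the limit (`exists_limiting_subgradient`), g is locally Lipschitz, so the η, and hence the ξ, are
bounded and have a weakly convergent subsequence. Minimality bounds the energies from above and
lower semicontinuity from below; they therefore converge, as weak closedness requires. -/

/-! ### A locally uniformly convex function on the dual -/

section DualEnergy

variable {V : Type*} [NormedAddCommGroup V] [NormedSpace ℝ V]

/-- The common kernel of the first `n` functionals of the sequence `e`. -/
def kernelTail (e : ℕ → StrongDual ℝ V) (n : ℕ) : Submodule ℝ V :=
  ⨅ i : Fin n, (e i : V →ₗ[ℝ] ℝ).ker

/-- The norm of the restriction of `ξ` to the common kernel of `e 0, …, e (n - 1)`; this is the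
distance of `ξ` from their span. -/
noncomputable def tailNorm (e : ℕ → StrongDual ℝ V) (n : ℕ) (ξ : StrongDual ℝ V) : ℝ :=
  ‖(ξ.comp (kernelTail e n).subtypeL : StrongDual ℝ (kernelTail e n))‖

/-- Troyanski–Kadec type function on the dual: a weighted sum of squares of the tail norms and of
the evaluations at the points `x n`. -/
noncomputable def dualEnergy (e : ℕ → StrongDual ℝ V) (x : ℕ → V) (ξ : StrongDual ℝ V) : ℝ :=
  ∑' n : ℕ, (1 / 2 : ℝ) ^ n * (tailNorm e n ξ ^ 2 + ξ (x n) ^ 2)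

variable {e : ℕ → StrongDual ℝ V} {x : ℕ → V} {n : ℕ}

lemma mem_kernelTail {v : V} : v ∈ kernelTail e n ↔ ∀ i < n, e i v = 0 := by
  simp only [kernelTail, Submodule.mem_iInf, LinearMap.mem_ker]
  exact ⟨fun h i hi => h ⟨i, hi⟩, fun h i => h i i.2⟩

lemma tailNorm_nonneg (ξ : StrongDual ℝ V) : 0 ≤ tailNorm e n ξ :=
  norm_nonneg (ξ.comp (kernelTail e n).subtypeL : StrongDual ℝ (kernelTail e n))

lemma tailNorm_le_norm (ξ : StrongDual ℝ V) : tailNorm e n ξ ≤ ‖ξ‖ := by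
  refine ContinuousLinearMap.opNorm_le_bound _ (norm_nonneg _) fun v => ?_
  simpa using ξ.le_opNorm (v : V)

lemma tailNorm_zero (ξ : StrongDual ℝ V) : tailNorm e 0 ξ = ‖ξ‖ := by
  refine le_antisymm (tailNorm_le_norm ξ) ?_
  refine ContinuousLinearMap.opNorm_le_bound _ (tailNorm_nonneg ξ) fun v => ?_
  have hv : v ∈ kernelTail e 0 := mem_kernelTail.2 fun i hi => absurd hi (Nat.not_lt_zero i)
  exact (ξ.comp (kernelTail e 0).subtypeL).le_opNorm ⟨v, hv⟩

lemma tailNorm_add_le (ξ η : StrongDual ℝ V) :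
    tailNorm e n (ξ + η) ≤ tailNorm e n ξ + tailNorm e n η := by
  unfold tailNorm
  rw [ContinuousLinearMap.add_comp]
  exact norm_add_le (ξ.comp (kernelTail e n).subtypeL : StrongDual ℝ (kernelTail e n))
    (η.comp (kernelTail e n).subtypeL : StrongDual ℝ (kernelTail e n))

lemma tailNorm_sub_le (ξ η : StrongDual ℝ V) :
    tailNorm e n (ξ - η) ≤ tailNorm e n ξ + tailNorm e n η := by
  unfold tailNorm
  rw [ContinuousLinearMap.sub_comp]
  exact norm_sub_le (ξ.comp (kernelTail e n).subtypeL : StrongDual ℝ (kernelTail e n))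
    (η.comp (kernelTail e n).subtypeL : StrongDual ℝ (kernelTail e n))

lemma tailNorm_smul_le (c : ℝ) (ξ : StrongDual ℝ V) :
    tailNorm e n (c • ξ) ≤ |c| * tailNorm e n ξ := by
  refine ContinuousLinearMap.opNorm_le_bound _
    (mul_nonneg (abs_nonneg c) (tailNorm_nonneg ξ)) fun v => ?_
  have h := (ξ.comp (kernelTail e n).subtypeL).le_opNorm v
  calc ‖c * ξ v‖ = |c| * ‖ξ v‖ := norm_mul _ _
    _ ≤ |c| * (tailNorm e n ξ * ‖v‖) := mul_le_mul_of_nonneg_left h (abs_nonneg c)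
    _ = |c| * tailNorm e n ξ * ‖v‖ := (mul_assoc _ _ _).symm

lemma tailNorm_eq_zero_of_mem_span {ξ : StrongDual ℝ V}
    (hξ : ξ ∈ Submodule.span ℝ (range fun i : Fin n => e i)) : tailNorm e n ξ = 0 := by
  unfold tailNorm
  refine (norm_eq_zero (a := (ξ.comp (kernelTail e n).subtypeL : StrongDual ℝ (kernelTail e n)))).2 ?_
  ext v
  have hv := mem_kernelTail.1 v.2
  simp only [ContinuousLinearMap.comp_apply, Submodule.subtypeL_apply,
    zero_apply]
  induction hξ using Submodule.span_induction with
  | mem η h => obtain ⟨i, rfl⟩ := h; exact hv i i.2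
  | zero => simp
  | add η ζ _ _ h1 h2 => simp [h1, h2]
  | smul c η _ h => simp [h]

/-- Tail norms tend to zero when the functionals `e i` span a dense subspace. -/
lemma exists_tailNorm_lt
    (he : (Submodule.span ℝ (range e)).topologicalClosure = ⊤)
    (ξ : StrongDual ℝ V) {ε : ℝ} (hε : 0 < ε) : ∃ n, tailNorm e n ξ < ε := by
  have hmem : ξ ∈ closure (Submodule.span ℝ (range e) : Set (StrongDual ℝ V)) := by
    rw [← Submodule.topologicalClosure_coe, he]; trivial
  obtain ⟨η, hη, hd⟩ := Metric.mem_closure_iff.1 hmem ε hε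
  have hspan : ∃ n, η ∈ Submodule.span ℝ (range fun i : Fin n => e i) := by
    have mono : ∀ {m k : ℕ}, m ≤ k → Submodule.span ℝ (range fun i : Fin m => e i) ≤
        Submodule.span ℝ (range fun i : Fin k => e i) := by
      intro m k hmk
      refine Submodule.span_mono ?_
      rintro _ ⟨i, rfl⟩
      exact ⟨⟨i, i.2.trans_le hmk⟩, rfl⟩
    clear hd
    induction hη using Submodule.span_induction with
    | mem η h =>
      obtain ⟨i, rfl⟩ := h
      exact ⟨i + 1, Submodule.subset_span ⟨⟨i, i.lt_succ_self⟩, rfl⟩⟩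
    | zero => exact ⟨0, Submodule.zero_mem _⟩
    | add η ζ _ _ h1 h2 =>
      obtain ⟨m, hm⟩ := h1
      obtain ⟨k, hk⟩ := h2
      exact ⟨max m k, Submodule.add_mem _ (mono (le_max_left _ _) hm) (mono (le_max_right _ _) hk)⟩
    | smul c η _ h =>
      obtain ⟨m, hm⟩ := h
      exact ⟨m, Submodule.smul_mem _ _ hm⟩
  obtain ⟨n, hn⟩ := hspan
  refine ⟨n, ?_⟩
  calc tailNorm e n ξ = tailNorm e n ((ξ - η) + η) := by rw [sub_add_cancel]
    _ ≤ tailNorm e n (ξ - η) + tailNorm e n η := tailNorm_add_le _ _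
    _ ≤ ‖ξ - η‖ + 0 := add_le_add (tailNorm_le_norm _) (tailNorm_eq_zero_of_mem_span hn).le
    _ < ε := by rwa [add_zero, ← dist_eq_norm]

/-- A functional differs from the span of `e 0, …, e (n - 1)` by a functional whose norm is the
`n`-th tail norm. -/
lemma exists_sub_mem_span (e : ℕ → StrongDual ℝ V) (n : ℕ) (ζ : StrongDual ℝ V) :
    ∃ η : StrongDual ℝ V, ‖η‖ = tailNorm e n ζ ∧
      ζ - η ∈ Submodule.span ℝ (range fun i : Fin n => e i) := by
  obtain ⟨η, hη, hn⟩ := exists_extension_norm_eq (kernelTail e n)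
    (ζ.comp (kernelTail e n).subtypeL)
  refine ⟨η, hn, ?_⟩
  have key : ((ζ - η : StrongDual ℝ V) : V →ₗ[ℝ] ℝ) ∈
      Submodule.span ℝ (range fun i : Fin n => (e i : V →ₗ[ℝ] ℝ)) := by
    refine mem_span_of_iInf_ker_le_ker fun v hv => ?_
    have := hη ⟨v, hv⟩
    simp only [ContinuousLinearMap.comp_apply, Submodule.subtypeL_apply] at this
    simp [this]
  rw [Submodule.mem_span_range_iff_exists_fun] at key ⊢
  obtain ⟨c, hc⟩ := key
  refine ⟨c, ?_⟩
  ext v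
  simpa using congrArg (fun f : V →ₗ[ℝ] ℝ => f v) hc

/-- Convergence of all tail norms together with pointwise convergence on a dense sequence implies
norm convergence. -/
lemma tendsto_of_tendsto_tailNorm
    (he : (Submodule.span ℝ (range e)).topologicalClosure = ⊤)
    {y : ℕ → V} (hy : DenseRange y) {a : StrongDual ℝ V} {b : ℕ → StrongDual ℝ V}
    (hp : ∀ n, Tendsto (fun j => tailNorm e n (b j)) atTop (𝓝 (tailNorm e n a)))
    (hb : ∀ n, Tendsto (fun j => b j (y n)) atTop (𝓝 (a (y n)))) :
    Tendsto b atTop (𝓝 a) := by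
  by_contra hcon
  rw [Metric.tendsto_atTop] at hcon
  push Not at hcon
  obtain ⟨ε, hε, hfreq⟩ := hcon
  obtain ⟨φ, hφ, hφε⟩ := extraction_of_frequently_atTop
    (frequently_atTop.2 fun N => (hfreq N).imp fun _ h => h)
  -- The tail norm of a bounds that of b (φ j) in the limit, so the difference eventually has tail
  -- norm below ε/8 + ε/8.
  obtain ⟨n, hn⟩ := exists_tailNorm_lt he a (show 0 < ε / 8 by positivity)
  have hζ : ∀ᶠ j in atTop, tailNorm e n (b (φ j) - a) < ε / 4 := by
    filter_upwards [((hp n).comp hφ.tendsto_atTop).eventually_lt_const hn] with j hj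
    have := tailNorm_sub_le (e := e) (n := n) (b (φ j)) a
    simp only [Function.comp] at hj
    linarith
  -- Split the difference into a small η and a part s in a finite-dimensional span; s is bounded,
  -- because the zeroth tail norm is the full norm, hence subconverges.
  choose η hη hmem using fun j => exists_sub_mem_span e n (b (φ j) - a)
  set W := Submodule.span ℝ (range fun i : Fin n => e i) with hW
  have : FiniteDimensional ℝ W := FiniteDimensional.span_of_finite ℝ (finite_range _)
  have : ProperSpace W := FiniteDimensional.proper ℝ W
  let s : ℕ → W := fun j => ⟨b (φ j) - a - η j, hmem j⟩
  have hbd : ∃ R, ∀ j, ‖s j‖ ≤ R := by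
    obtain ⟨R, hR⟩ := (hp 0).bddAbove_range
    refine ⟨2 * (R + ‖a‖), fun j => ?_⟩
    have h1 : ‖b (φ j)‖ ≤ R := by
      rw [← tailNorm_zero (e := e)]; exact hR ⟨φ j, rfl⟩
    have h2 : ‖η j‖ ≤ ‖b (φ j) - a‖ := (hη j).le.trans (tailNorm_le_norm _)
    have h3 : ‖s j‖ ≤ ‖b (φ j) - a‖ + ‖η j‖ := norm_sub_le (b (φ j) - a) (η j)
    have h4 := norm_sub_le (b (φ j)) a
    linarith
  obtain ⟨R, hR⟩ := hbd
  obtain ⟨σ, -, ψ, hψ, hσ⟩ := tendsto_subseq_of_bounded (Metric.isBounded_closedBall (x := (0 : W))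
    (r := R)) (x := s) (fun j => by
      rw [Metric.mem_closedBall, Subtype.dist_eq, dist_eq_norm, ZeroMemClass.coe_zero, sub_zero]
      exact hR j)
  have hσ' : Tendsto (fun j => (s (ψ j) : StrongDual ℝ V)) atTop (𝓝 (σ : StrongDual ℝ V)) :=
    (continuous_subtype_val.tendsto _).comp hσ
  -- On the dense sequence the whole difference tends to 0, so there σ is the limit of -η and
  -- inherits its bound ε/4.
  have hσn : ‖(σ : StrongDual ℝ V)‖ ≤ ε / 4 := by
    refine ContinuousLinearMap.opNorm_le_bound _ (by positivity) ?_
    intro v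
    refine hy.induction_on (p := fun v => ‖(σ : StrongDual ℝ V) v‖ ≤ ε / 4 * ‖v‖) v ?_ ?_
    · exact isClosed_le (by fun_prop) (by fun_prop)
    · intro i
      have t1 : Tendsto (fun j => (s (ψ j) : StrongDual ℝ V) (y i)) atTop
          (𝓝 ((σ : StrongDual ℝ V) (y i))) :=
        ((ContinuousLinearMap.apply ℝ ℝ (y i)).continuous.tendsto _).comp hσ'
      have t2 : Tendsto (fun j => b (φ (ψ j)) (y i) - a (y i)) atTop (𝓝 0) := by
        have := ((hb i).comp (hφ.tendsto_atTop.comp hψ.tendsto_atTop)).sub_const (a (y i))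
        simpa using this
      have t3 := (t1.sub t2).norm
      rw [sub_zero] at t3
      refine le_of_tendsto t3 ?_
      filter_upwards [hψ.tendsto_atTop.eventually hζ] with j hj
      have : (s (ψ j) : StrongDual ℝ V) (y i) - (b (φ (ψ j)) (y i) - a (y i)) = -(η (ψ j) (y i)) := by
        simp [s]
      rw [this, norm_neg]
      refine ((η (ψ j)).le_opNorm _).trans ?_
      gcongr
      rw [hη]; exact hj.le
  have hfin : ∀ᶠ j in atTop, ‖(s (ψ j) : StrongDual ℝ V) - σ‖ < ε / 4 := by
    have := (tendsto_iff_norm_sub_tendsto_zero.1 hσ').eventually_lt_const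
      (show 0 < ε / 4 by positivity)
    exact this
  obtain ⟨j, hj1, hj2⟩ := (hfin.and (hψ.tendsto_atTop.eventually hζ)).exists
  have h1 := hφε (ψ j)
  rw [dist_eq_norm] at h1
  have h2 : b (φ (ψ j)) - a = ((s (ψ j) : StrongDual ℝ V) - σ) + σ + η (ψ j) := by
    simp [s]
  have h3 := norm_add₃_le (a := (s (ψ j) : StrongDual ℝ V) - σ) (b := (σ : StrongDual ℝ V))
    (c := η (ψ j))
  rw [← h2, hη] at h3
  linarith

/-- In a reflexive space, a sequence of functionals separating points spans a dense subspace. -/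
lemma topologicalClosure_span_eq_top_of_separating (hV : IsReflexiveSpace V)
    (hsep : ∀ v : V, (∀ i, e i v = 0) → v = 0) :
    (Submodule.span ℝ (range e)).topologicalClosure = ⊤ := by
  rw [Submodule.eq_top_iff']
  intro ξ
  by_contra hξ
  set W := (Submodule.span ℝ (range e)).topologicalClosure
  obtain ⟨f, u, hf, hu⟩ := geometric_hahn_banach_closed_point (s := (W : Set (StrongDual ℝ V)))
    W.convex (Submodule.isClosed_topologicalClosure _) hξ
  have hu0 : 0 < u := by simpa using hf 0 W.zero_mem
  have hzero : ∀ η ∈ W, f η = 0 := by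
    intro η hη
    by_contra hne
    -- This multiple of η has f-value exactly u, contradicting the strict separation.
    have := hf ((u / f η) • η) (W.smul_mem _ hη)
    rw [map_smul, smul_eq_mul, div_mul_cancel₀ _ hne] at this
    exact lt_irrefl _ this
  obtain ⟨v, rfl⟩ := hV f
  have hv : v = 0 := hsep v fun i => by
    simpa using hzero (e i) (Submodule.le_topologicalClosure _ (Submodule.subset_span ⟨i, rfl⟩))
  rw [hv] at hu
  simp only [map_zero, zero_apply] at hu
  exact absurd hu hu0.le.not_gt

/-- A separable normed space carries a sequence of continuous functionals separating points. -/
lemma exists_separating_sequence {y : ℕ → V} (hy : DenseRange y) :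
    ∃ e : ℕ → StrongDual ℝ V, ∀ v : V, (∀ i, e i v = 0) → v = 0 := by
  choose e he1 he2 using fun i => exists_dual_vector'' ℝ (y i)
  refine ⟨e, fun v hv => ?_⟩
  by_contra hne
  obtain ⟨i, hi⟩ := hy.exists_dist_lt v (show 0 < ‖v‖ / 2 by positivity)
  rw [dist_eq_norm] at hi
  -- Since e i kills v and norms y i, the vector y i is no longer than its distance to v.
  have h1 : ‖y i‖ ≤ ‖v - y i‖ := by
    have h2 : e i (y i - v) = ‖y i‖ := by simp [he2, hv]
    calc ‖y i‖ = e i (y i - v) := h2.symm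
      _ ≤ ‖e i (y i - v)‖ := Real.le_norm_self _
      _ ≤ 1 * ‖y i - v‖ := (e i).le_of_opNorm_le (he1 i) _
      _ = ‖v - y i‖ := by rw [one_mul, norm_sub_rev]
  have h3 : ‖v‖ ≤ ‖v - y i‖ + ‖y i‖ := by simpa using norm_add_le (v - y i) (y i)
  linarith

lemma dualEnergy_term_le (hx : ∀ n, ‖x n‖ ≤ 1) (ξ : StrongDual ℝ V) (n : ℕ) :
    (1 / 2 : ℝ) ^ n * (tailNorm e n ξ ^ 2 + ξ (x n) ^ 2) ≤ (1 / 2 : ℝ) ^ n * (2 * ‖ξ‖ ^ 2) := by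
  have h1 : tailNorm e n ξ ^ 2 ≤ ‖ξ‖ ^ 2 :=
    pow_le_pow_left₀ (tailNorm_nonneg _) (tailNorm_le_norm _) 2
  have h2 : ξ (x n) ^ 2 ≤ ‖ξ‖ ^ 2 := by
    rw [← sq_abs]
    refine pow_le_pow_left₀ (abs_nonneg _) ?_ 2
    exact (ξ.le_opNorm_of_le (hx n)).trans_eq (mul_one _)
  gcongr
  linarith

lemma dualEnergy_term_nonneg (ξ : StrongDual ℝ V) (n : ℕ) :
    0 ≤ (1 / 2 : ℝ) ^ n * (tailNorm e n ξ ^ 2 + ξ (x n) ^ 2) := by positivity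

lemma summable_dualEnergy (hx : ∀ n, ‖x n‖ ≤ 1) (ξ : StrongDual ℝ V) :
    Summable fun n : ℕ => (1 / 2 : ℝ) ^ n * (tailNorm e n ξ ^ 2 + ξ (x n) ^ 2) :=
  Summable.of_nonneg_of_le (dualEnergy_term_nonneg ξ) (dualEnergy_term_le hx ξ)
    (summable_geometric_two.mul_right _)

lemma dualEnergy_le (hx : ∀ n, ‖x n‖ ≤ 1) (ξ : StrongDual ℝ V) :
    dualEnergy e x ξ ≤ 4 * ‖ξ‖ ^ 2 := by
  calc dualEnergy e x ξ ≤ ∑' n : ℕ, (1 / 2 : ℝ) ^ n * (2 * ‖ξ‖ ^ 2) :=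
        (summable_dualEnergy hx ξ).tsum_le_tsum (dualEnergy_term_le hx ξ)
          (summable_geometric_two.mul_right _)
    _ = 4 * ‖ξ‖ ^ 2 := by rw [tsum_mul_right, tsum_geometric_two]; ring

lemma le_dualEnergy (hx : ∀ n, ‖x n‖ ≤ 1) (ξ : StrongDual ℝ V) :
    ‖ξ‖ ^ 2 ≤ dualEnergy e x ξ := by
  have := (summable_dualEnergy (e := e) hx ξ).le_tsum 0 fun n _ => dualEnergy_term_nonneg ξ n
  rw [pow_zero, one_mul, tailNorm_zero] at this
  exact (le_add_of_nonneg_right (sq_nonneg _)).trans this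

/-- The identity s² + t² - 2((s + t)/2)² = (s - t)²/2, applied to each square, makes every term of
the midpoint gap nonnegative; any single term is then bounded by the total. -/
lemma dualEnergy_gap (hx : ∀ n, ‖x n‖ ≤ 1) (a b : StrongDual ℝ V) (n : ℕ) :
    (1 / 2 : ℝ) ^ n * (((tailNorm e n a - tailNorm e n b) ^ 2 + (a (x n) - b (x n)) ^ 2) / 2) ≤
      dualEnergy e x a + dualEnergy e x b - 2 * dualEnergy e x ((1 / 2 : ℝ) • (a + b)) := by
  have hsum := (((summable_dualEnergy (e := e) hx a).hasSum.add
    (summable_dualEnergy (e := e) hx b).hasSum).sub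
    ((summable_dualEnergy (e := e) hx ((1 / 2 : ℝ) • (a + b))).hasSum.mul_left 2))
  have hterm : ∀ m, (1 / 2 : ℝ) ^ m *
      (((tailNorm e m a - tailNorm e m b) ^ 2 + (a (x m) - b (x m)) ^ 2) / 2) ≤
      (1 / 2 : ℝ) ^ m * (tailNorm e m a ^ 2 + a (x m) ^ 2) +
        (1 / 2 : ℝ) ^ m * (tailNorm e m b ^ 2 + b (x m) ^ 2) -
        2 * ((1 / 2 : ℝ) ^ m * (tailNorm e m ((1 / 2 : ℝ) • (a + b)) ^ 2 +
          ((1 / 2 : ℝ) • (a + b)) (x m) ^ 2)) := by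
    intro m
    have h1 : tailNorm e m ((1 / 2 : ℝ) • (a + b)) ^ 2 ≤
        ((tailNorm e m a + tailNorm e m b) / 2) ^ 2 := by
      refine pow_le_pow_left₀ (tailNorm_nonneg _) ?_ 2
      have h0 := tailNorm_smul_le (e := e) (n := m) (1 / 2) (a + b)
      rw [abs_of_pos (by norm_num)] at h0
      have := tailNorm_add_le (e := e) (n := m) a b
      linarith
    have h2 : ((1 / 2 : ℝ) • (a + b)) (x m) = (a (x m) + b (x m)) / 2 := by
      simp; ring
    rw [h2]
    have h3 : (0 : ℝ) ≤ (1 / 2) ^ m := by positivity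
    have h4 := mul_le_mul_of_nonneg_left h1 h3
    linarith [h4]
  refine (hterm n).trans ?_
  refine (le_hasSum hsum n fun m _ => (le_trans ?_ (hterm m)))
  positivity

/-- Local uniform convexity of the dual energy. -/
lemma tendsto_of_dualEnergy_gap
    (he : (Submodule.span ℝ (range e)).topologicalClosure = ⊤)
    {y : ℕ → V} (hy : DenseRange y) (hxy : ∀ n, x n = (1 + ‖y n‖)⁻¹ • y n)
    (hx : ∀ n, ‖x n‖ ≤ 1) {a : StrongDual ℝ V} {b : ℕ → StrongDual ℝ V} {c : ℕ → ℝ}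
    (hgap : ∀ j, dualEnergy e x a + dualEnergy e x (b j) -
      2 * dualEnergy e x ((1 / 2 : ℝ) • (a + b j)) ≤ c j) (hc : Tendsto c atTop (𝓝 0)) :
    Tendsto b atTop (𝓝 a) := by
  have hbound : ∀ n j, (tailNorm e n a - tailNorm e n (b j)) ^ 2 +
      (a (x n) - b j (x n)) ^ 2 ≤ 2 * 2 ^ n * c j := by
    intro n j
    have h := (dualEnergy_gap (e := e) hx a (b j) n).trans (hgap j)
    have h2 : (0 : ℝ) < 2 ^ n := by positivity
    rw [one_div, inv_pow] at h
    have h3 := mul_le_mul_of_nonneg_left h h2.le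
    rw [← mul_assoc, mul_inv_cancel₀ h2.ne', one_mul] at h3
    linarith
  have hz : ∀ n, Tendsto (fun j => 2 * 2 ^ n * c j) atTop (𝓝 0) := fun n => by
    simpa using hc.const_mul (2 * 2 ^ n : ℝ)
  have aux : ∀ {w : ℕ → ℝ} {w₀ : ℝ} (n : ℕ), (∀ j, (w₀ - w j) ^ 2 ≤ 2 * 2 ^ n * c j) →
      Tendsto w atTop (𝓝 w₀) := by
    intro w w₀ n h
    have h1 : Tendsto (fun j => (w₀ - w j) ^ 2) atTop (𝓝 0) :=
      squeeze_zero (fun j => sq_nonneg _) h (hz n)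
    have h2 := (Real.continuous_sqrt.tendsto 0).comp h1
    simp only [Real.sqrt_zero, Function.comp_def, Real.sqrt_sq_eq_abs] at h2
    rw [tendsto_iff_norm_sub_tendsto_zero]
    simpa [abs_sub_comm] using h2
  refine tendsto_of_tendsto_tailNorm he hy (fun n => aux n fun j => ?_) fun n => ?_
  · exact (le_add_of_nonneg_right (sq_nonneg _)).trans (hbound n j)
  · have h := aux (w := fun j => b j (x n)) n fun j =>
      (le_add_of_nonneg_left (sq_nonneg _)).trans (hbound n j)
    have hpos : (0 : ℝ) < 1 + ‖y n‖ := by positivity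
    -- Undoes the normalization of y n to x n, which only serves summability.
    have h2 := h.const_mul (1 + ‖y n‖)
    simpa [hxy, ← mul_assoc, mul_inv_cancel₀ hpos.ne'] using h2

/-- An operator norm bound is an intersection of conditions on single evaluations. The clause 0 ≤ r
covers negative r when the kernel is trivial. -/
lemma isClosed_tailNorm_le (r : ℝ) :
    IsClosed {ξ : WeakDual ℝ V | tailNorm e n (WeakDual.toStrongDual ξ) ≤ r} := by
  have : {ξ : WeakDual ℝ V | tailNorm e n (WeakDual.toStrongDual ξ) ≤ r} =
      ⋂ v : kernelTail e n, {ξ : WeakDual ℝ V | ‖ξ (v : V)‖ ≤ r * ‖v‖ ∧ 0 ≤ r} := by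
    ext ξ
    simp only [mem_ofPred_eq, mem_iInter]
    constructor
    · intro h v
      exact ⟨(((WeakDual.toStrongDual ξ).comp (kernelTail e n).subtypeL).le_of_opNorm_le h v),
        (tailNorm_nonneg _).trans h⟩
    · intro h
      exact ContinuousLinearMap.opNorm_le_bound _ (h 0).2 fun v => (h v).1
  rw [this]
  refine isClosed_iInter fun v => ?_
  refine IsClosed.and ?_ isClosed_const
  exact isClosed_le (WeakDual.eval_continuous (v : V)).norm continuous_const

/-- The terms are nonnegative and weak* lower semicontinuous, and the series is the supremum of its
partial sums. -/
lemma lowerSemicontinuous_dualEnergy (hx : ∀ n, ‖x n‖ ≤ 1) :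
    LowerSemicontinuous fun ξ : WeakDual ℝ V => dualEnergy e x (WeakDual.toStrongDual ξ) := by
  have hterm : ∀ n, LowerSemicontinuous fun ξ : WeakDual ℝ V => (1 / 2 : ℝ) ^ n *
      (tailNorm e n (WeakDual.toStrongDual ξ) ^ 2 + (WeakDual.toStrongDual ξ) (x n) ^ 2) := by
    intro n
    have h1 : LowerSemicontinuous fun ξ : WeakDual ℝ V =>
        tailNorm e n (WeakDual.toStrongDual ξ) ^ 2 := by
      rw [lowerSemicontinuous_iff_isClosed_preimage]
      intro r
      rcases lt_or_ge r 0 with hr | hr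
      · convert isClosed_empty
        ext ξ
        simp only [mem_preimage, mem_Iic, mem_empty_iff_false, iff_false, not_le]
        exact hr.trans_le (sq_nonneg _)
      · convert isClosed_tailNorm_le (e := e) (n := n) (√r) using 1
        ext ξ
        simp only [mem_preimage, mem_Iic, mem_ofPred_eq]
        exact (Real.le_sqrt (tailNorm_nonneg _) hr).symm
    have h2 : Continuous fun ξ : WeakDual ℝ V => (WeakDual.toStrongDual ξ) (x n) ^ 2 :=
      (WeakDual.eval_continuous (x n)).pow 2
    exact (continuous_const_mul ((1 / 2 : ℝ) ^ n)).comp_lowerSemicontinuous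
      (h1.add h2.lowerSemicontinuous) (fun _ _ h => mul_le_mul_of_nonneg_left h (by positivity))
  have hbdd : ∀ ξ : WeakDual ℝ V, BddAbove (range fun N : ℕ => ∑ n ∈ Finset.range N,
      (1 / 2 : ℝ) ^ n * (tailNorm e n (WeakDual.toStrongDual ξ) ^ 2 +
        (WeakDual.toStrongDual ξ) (x n) ^ 2)) := fun ξ =>
    ⟨dualEnergy e x (WeakDual.toStrongDual ξ), by
      rintro _ ⟨N, rfl⟩
      exact (summable_dualEnergy hx _).sum_le_tsum _ fun n _ => dualEnergy_term_nonneg _ n⟩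
  have hsup := lowerSemicontinuous_ciSup hbdd fun N => lowerSemicontinuous_sum fun n _ => hterm n
  have heq : ∀ ξ : WeakDual ℝ V, dualEnergy e x (WeakDual.toStrongDual ξ) =
      ⨆ N : ℕ, ∑ n ∈ Finset.range N, (1 / 2 : ℝ) ^ n *
        (tailNorm e n (WeakDual.toStrongDual ξ) ^ 2 + (WeakDual.toStrongDual ξ) (x n) ^ 2) := by
    intro ξ
    refine tendsto_nhds_unique (summable_dualEnergy hx _).hasSum.tendsto_sum_nat
      (tendsto_atTop_ciSup ?_ (hbdd ξ))
    intro M N hMN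
    exact Finset.sum_le_sum_of_subset_of_nonneg (Finset.range_mono hMN)
      fun n _ _ => dualEnergy_term_nonneg _ n
  simp only [heq]
  exact hsup

end DualEnergy

/-! ### A Fréchet smooth function with quadratic growth -/

/-- A reflexive separable space carries a Fréchet differentiable function comparable with the
square of the norm. -/
theorem exists_smooth_quadratic {V : Type*} [NormedAddCommGroup V] [NormedSpace ℝ V]
    [TopologicalSpace.SeparableSpace V] (hV : IsReflexiveSpace V) :
    ∃ (h : V → ℝ) (J : V → StrongDual ℝ V), h 0 = 0 ∧ (∀ x, ‖x‖ ^ 2 / 16 ≤ h x) ∧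
      (∀ x, ‖J x‖ ≤ ‖x‖) ∧ ∀ x, HasFDerivAt h (J x) x := by
  obtain ⟨y, hy⟩ := TopologicalSpace.exists_dense_seq V
  obtain ⟨e, hsep⟩ := exists_separating_sequence hy
  have he := topologicalClosure_span_eq_top_of_separating hV hsep
  obtain ⟨p, hp⟩ : ∃ p : ℕ → V, ∀ n, p n = (1 + ‖y n‖)⁻¹ • y n := ⟨_, fun _ => rfl⟩
  have hp1 : ∀ n, ‖p n‖ ≤ 1 := fun n => by
    rw [hp, norm_smul, norm_inv, Real.norm_of_nonneg (by positivity), inv_mul_le_iff₀ (by positivity)]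
    linarith [norm_nonneg (y n)]
  set k := dualEnergy e p with hk
  have hk0 : k 0 = 0 := le_antisymm (by simpa using dualEnergy_le (e := e) hp1 0)
    (by simpa using le_dualEnergy (e := e) hp1 0)
  -- Banach–Alaoglu gives a maximizer on the ball of radius ‖x‖. Outside it k η - η x ≥ ‖η‖(‖η‖ -
  -- ‖x‖) > 0, which is worse than η = 0.
  have hmax : ∀ x : V, ∃ ξ : StrongDual ℝ V, ‖ξ‖ ≤ ‖x‖ ∧ ∀ η : StrongDual ℝ V,
      η x - k η ≤ ξ x - k ξ := by
    intro x
    have hl : LowerSemicontinuous fun ξ : WeakDual ℝ V =>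
        k (WeakDual.toStrongDual ξ) + -(ξ x) :=
      (lowerSemicontinuous_dualEnergy hp1).add (WeakDual.eval_continuous x).neg.lowerSemicontinuous
    obtain ⟨ξ, hξ, hmin⟩ := LowerSemicontinuousOn.exists_isMinOn
      (s := WeakDual.toStrongDual ⁻¹' Metric.closedBall (0 : StrongDual ℝ V) ‖x‖)
      ⟨0, by simp⟩ (WeakDual.isCompact_closedBall _ _) (hl.lowerSemicontinuousOn _)
    refine ⟨WeakDual.toStrongDual ξ, by simpa using hξ, fun η => ?_⟩
    have hcomp : ∀ ζ : StrongDual ℝ V, ‖ζ‖ ≤ ‖x‖ →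
        k (WeakDual.toStrongDual ξ) - (WeakDual.toStrongDual ξ) x ≤ k ζ - ζ x := by
      intro ζ hζ
      have := hmin (a := StrongDual.toWeakDual ζ) (by simpa using hζ)
      simpa [sub_eq_add_neg] using this
    rcases le_or_gt ‖η‖ ‖x‖ with hη | hη
    · have := hcomp η hη
      linarith
    · have h0 := hcomp 0 (by simp)
      have h1 : ‖η‖ ^ 2 ≤ k η := le_dualEnergy hp1 η
      have h2 : η x ≤ ‖η‖ * ‖x‖ := (Real.le_norm_self _).trans (η.le_opNorm x)
      have h3 : ‖η‖ * ‖x‖ ≤ ‖η‖ * ‖η‖ := mul_le_mul_of_nonneg_left hη.le (norm_nonneg _)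
      simp only [hk0, zero_apply, sub_zero] at h0
      nlinarith
  choose J hJ hJmax using hmax
  refine ⟨fun x => J x x - k (J x), J, ?_, ?_, hJ, ?_⟩
  · have h0 : J 0 = 0 := by simpa using hJ 0
    simp [h0, hk0]
  · intro x
    obtain ⟨g, hg1, hg2⟩ := exists_dual_vector'' ℝ x
    -- The factor 1/8 maximizes s - 4s², with value 1/16.
    have h1 := hJmax x ((‖x‖ / 8) • g)
    have h2 : k ((‖x‖ / 8) • g) ≤ 4 * ‖(‖x‖ / 8) • g‖ ^ 2 := dualEnergy_le hp1 _
    have h3 : ‖(‖x‖ / 8) • g‖ ≤ ‖x‖ / 8 := by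
      rw [norm_smul, Real.norm_of_nonneg (by positivity)]
      exact mul_le_of_le_one_right (by positivity) hg1
    have h4 := pow_le_pow_left₀ (norm_nonneg _) h3 2
    have h5 : ((‖x‖ / 8) • g) x = ‖x‖ / 8 * ‖x‖ := by simp [hg2]
    rw [h5] at h1
    show ‖x‖ ^ 2 / 16 ≤ J x x - k (J x)
    nlinarith
  · intro x
    have hlow : ∀ z, J x z - k (J x) ≤ J z z - k (J z) := fun z => hJmax z (J x)
    have hup : ∀ z, J z x - k (J z) ≤ J x x - k (J x) := fun z => hJmax x (J z)
    have hcont : Tendsto J (𝓝 x) (𝓝 (J x)) := by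
      refine tendsto_of_seq_tendsto fun z hz => ?_
      refine tendsto_of_dualEnergy_gap he hy hp hp1
        (c := fun j => (‖z j‖ + ‖x‖) * ‖z j - x‖) (fun j => ?_) ?_
      -- Testing maximality at x with the midpoint, and at z j with J x, bounds the midpoint gap of
      -- k by (J (z j) - J x)(z j - x).
      · have h1 := hJmax x ((1 / 2 : ℝ) • (J x + J (z j)))
        have h2 := hlow (z j)
        have h3 : (J (z j) - J x) (z j - x) ≤ (‖z j‖ + ‖x‖) * ‖z j - x‖ :=
          (Real.le_norm_self _).trans (((J (z j) - J x).le_opNorm _).trans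
            (mul_le_mul_of_nonneg_right ((norm_sub_le _ _).trans
              (add_le_add (hJ _) (hJ _))) (norm_nonneg _)))
        simp only [smul_apply, add_apply,
          sub_apply, smul_eq_mul, map_sub] at h1 h3
        show k (J x) + k (J (z j)) - 2 * k ((1 / 2 : ℝ) • (J x + J (z j))) ≤ _
        linarith
      · have h1 := (tendsto_iff_norm_sub_tendsto_zero.1 hz)
        simpa using (hz.norm.add_const ‖x‖).mul h1
    rw [hasFDerivAt_iff_isLittleO, Asymptotics.isLittleO_iff]
    intro ε hε
    -- The remainder h z - h x - J x (z - x) lies between 0 and (J z - J x)(z - x).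
    filter_upwards [hcont.eventually (Metric.closedBall_mem_nhds _ hε)] with z hz
    have h1 := hlow z
    have h2 := hup z
    have h3 : (J z - J x) (z - x) ≤ ε * ‖z - x‖ :=
      (Real.le_norm_self _).trans (((J z - J x).le_opNorm _).trans
        (mul_le_mul_of_nonneg_right (by simpa [dist_eq_norm] using hz) (norm_nonneg _)))
    simp only [sub_apply, map_sub] at h3 ⊢
    rw [Real.norm_of_nonneg (by linarith)]
    linarith

/-! ### A smooth variational principle -/

/-- Take a point within ε of the infimum, unless u itself has a smaller value, in which case u
serves. -/
lemma exists_almost_minimizer {X : Type*} {K : Set X} {φ θ : X → ℝ} {B ε : ℝ} (hB : ∀ w ∈ K, B ≤ φ w)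
    (hθ : ∀ w, 0 ≤ θ w) (hε : 0 < ε) {u : X} (hu : u ∈ K) :
    ∃ v ∈ K, φ v + θ v ≤ φ u + θ u ∧ ∀ w ∈ K, φ v + θ v ≤ φ w + θ w + ε := by
  have hbdd : BddBelow ((fun w => φ w + θ w) '' K) := ⟨B, by
    rintro _ ⟨w, hw, rfl⟩
    exact (hB w hw).trans (le_add_of_nonneg_right (hθ w))⟩
  obtain ⟨_, ⟨v, hv, rfl⟩, hlt⟩ := Real.lt_sInf_add_pos (⟨_, u, hu, rfl⟩ :
    ((fun w => φ w + θ w) '' K).Nonempty) hε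
  have hle : ∀ w ∈ K, sInf ((fun w => φ w + θ w) '' K) ≤ φ w + θ w :=
    fun w hw => csInf_le hbdd ⟨w, hw, rfl⟩
  rcases le_total (φ v + θ v) (φ u + θ u) with h | h
  · exact ⟨v, hv, h, fun w hw => by have := hle w hw; simp only at hlt; linarith⟩
  · exact ⟨u, hu, le_rfl, fun w hw => by have := hle w hw; simp only at hlt; linarith⟩

section VariationalPrinciple

variable {X : Type*} [NormedAddCommGroup X] [NormedSpace ℝ X]

lemma le_mul_norm_sq_of_hasFDerivAt {h : X → ℝ} {J : X → StrongDual ℝ X} {L : ℝ} (hL : 0 ≤ L)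
    (h0 : h 0 = 0) (hJ : ∀ x, ‖J x‖ ≤ L * ‖x‖) (hd : ∀ x, HasFDerivAt h (J x) x) (z : X) :
    h z ≤ L * ‖z‖ ^ 2 := by
  have := (convex_closedBall (0 : X) ‖z‖).norm_image_sub_le_of_norm_hasFDerivWithin_le
    (fun x _ => (hd x).hasFDerivWithinAt) (C := L * ‖z‖) (fun x hx => (hJ x).trans
      (mul_le_mul_of_nonneg_left (mem_closedBall_zero_iff.1 hx) hL))
    (x := 0) (y := z) (by simp) (by simp)
  rw [h0, sub_zero, sub_zero] at this
  calc h z ≤ ‖h z‖ := Real.le_norm_self _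
    _ ≤ L * ‖z‖ * ‖z‖ := this
    _ = L * ‖z‖ ^ 2 := by ring

/-- Borwein–Preiss smooth variational principle: an almost minimizer of a lower semicontinuous
function on a closed set can be moved slightly to an exact minimizer of a smooth perturbation with
small derivative there. -/
theorem smooth_variational_principle [CompleteSpace X] {h : X → ℝ} {J : X → StrongDual ℝ X}
    {c L ρ : ℝ} (hc : 0 < c) (hL : 0 ≤ L) (hρ : 0 < ρ) (h0 : h 0 = 0)
    (hlow : ∀ x, c * ‖x‖ ^ 2 ≤ h x) (hJ : ∀ x, ‖J x‖ ≤ L * ‖x‖)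
    (hd : ∀ x, HasFDerivAt h (J x) x) {K : Set X} (hK : IsClosed K) {φ : X → ℝ}
    (hφ : LowerSemicontinuousOn φ K) {x₀ : X} (hx₀ : x₀ ∈ K)
    (hmin : ∀ w ∈ K, φ x₀ ≤ φ w + c * ρ ^ 2) :
    ∃ x ∈ K, ∃ (Θ : X → ℝ) (Λ : StrongDual ℝ X), ‖x - x₀‖ ≤ 2 * ρ ∧ HasFDerivAt Θ Λ x ∧
      ‖Λ‖ ≤ 4 * L * ρ ∧ (∀ w, 0 ≤ Θ w) ∧ φ x + Θ x ≤ φ x₀ ∧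
      ∀ w ∈ K, φ x + Θ x ≤ φ w + Θ w := by
  have hh : ∀ x, 0 ≤ h x := fun x => le_trans (by positivity) (hlow x)
  have hhc : Continuous h := continuous_iff_continuousAt.2 fun x => (hd x).continuousAt
  -- With penalty weights 2⁻ⁱ, the tolerance 8⁻ⁱ makes the i-th step at most ρ2⁻ⁱ, so the total
  -- displacement is at most 2ρ.
  set δ : ℕ → ℝ := fun i => c * ρ ^ 2 * (1 / 8 : ℝ) ^ i with hδ
  have hδpos : ∀ i, 0 < δ i := fun i => by positivity
  have hstep : ∀ (i : ℕ) (θ : X → ℝ) (u : X), (∀ w, 0 ≤ θ w) → u ∈ K →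
      ∃ v, v ∈ K ∧ φ v + θ v ≤ φ u + θ u ∧ ∀ w ∈ K, φ v + θ v ≤ φ w + θ w + δ i :=
    fun i θ u hθ hu => exists_almost_minimizer (B := φ x₀ - c * ρ ^ 2)
      (fun w hw => by linarith [hmin w hw]) hθ (hδpos i) hu
  choose! next hnK hnle hnmin using hstep
  -- The state is the pair (θ i, u i): a penalty centred at u i is added before the next almost
  -- minimizer is chosen.
  let st : ℕ → (X → ℝ) × X := fun n => Nat.rec ((fun _ => 0), x₀) (fun i p =>
    ((fun w => p.1 w + (1 / 2 : ℝ) ^ i * h (w - p.2)),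
      next (i + 1) (fun w => p.1 w + (1 / 2 : ℝ) ^ i * h (w - p.2)) p.2)) n
  obtain ⟨u, hu⟩ : ∃ u : ℕ → X, ∀ i, u i = (st i).2 := ⟨_, fun _ => rfl⟩
  obtain ⟨θ, hθ⟩ : ∃ θ : ℕ → X → ℝ, ∀ i, θ i = (st i).1 := ⟨_, fun _ => rfl⟩
  have hu0 : u 0 = x₀ := hu 0
  have hθ0 : θ 0 = fun _ => 0 := hθ 0
  have hθs : ∀ i w, θ (i + 1) w = θ i w + (1 / 2 : ℝ) ^ i * h (w - u i) := by
    intro i w; rw [hθ, hθ, hu]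
  have hus : ∀ i, u (i + 1) = next (i + 1) (θ (i + 1)) (u i) := by
    intro i; rw [hu, hu, hθ]
  clear_value st
  clear hu hθ
  have hθsum : ∀ i w, θ i w = ∑ j ∈ Finset.range i, (1 / 2 : ℝ) ^ j * h (w - u j) := by
    intro i w
    induction i with
    | zero => simp [hθ0]
    | succ i ih => rw [hθs, ih, Finset.sum_range_succ]
  have hterm : ∀ j w, 0 ≤ (1 / 2 : ℝ) ^ j * h (w - u j) :=
    fun j w => mul_nonneg (by positivity) (hh _)
  have hθnn : ∀ i w, 0 ≤ θ i w := fun i w => by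
    rw [hθsum]; exact Finset.sum_nonneg fun j _ => hterm j w
  have hθmono : ∀ {i j} w, i ≤ j → θ i w ≤ θ j w := fun {i j} w hij => by
    rw [hθsum, hθsum]
    exact Finset.sum_le_sum_of_subset_of_nonneg (Finset.range_mono hij) fun k _ _ => hterm k w
  have hθc : ∀ i, Continuous (θ i) := fun i => by
    rw [funext (hθsum i)]
    exact continuous_finsetSum _ fun j _ => continuous_const.mul
      (hhc.comp (continuous_id.sub continuous_const))
  have huK : ∀ i, u i ∈ K := by
    intro i
    induction i with
    | zero => rwa [hu0]
    | succ i ih => rw [hus]; exact hnK _ _ _ (hθnn _) ih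
  have hself : ∀ i, θ (i + 1) (u i) = θ i (u i) := fun i => by
    rw [hθs, sub_self, h0, mul_zero, add_zero]
  have hdec : ∀ i, φ (u (i + 1)) + θ (i + 1) (u (i + 1)) ≤ φ (u i) + θ i (u i) := fun i => by
    have := hnle (i + 1) (θ (i + 1)) (u i) (hθnn _) (huK i)
    rwa [hself, ← hus] at this
  have hdec0 : ∀ i, φ (u i) + θ i (u i) ≤ φ x₀ := by
    intro i
    induction i with
    | zero => simp [hu0, hθ0]
    | succ i ih => exact (hdec i).trans ih
  have halm : ∀ i, ∀ w ∈ K, φ (u i) + θ i (u i) ≤ φ w + θ i w + δ i := by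
    intro i w hw
    cases i with
    | zero => simpa [hu0, hθ0, hδ] using hmin w hw
    | succ i => rw [hus]; exact hnmin _ _ _ (hθnn _) (huK i) w hw
  have hdist : ∀ i, dist (u i) (u (i + 1)) ≤ ρ * (1 / 2 : ℝ) ^ i := by
    intro i
    rw [dist_eq_norm, norm_sub_rev]
    have h1 := halm i _ (huK (i + 1))
    have h2 := hdec i
    rw [hθs] at h2
    have h3 := hlow (u (i + 1) - u i)
    have h4 : (1 / 2 : ℝ) ^ i * (c * ‖u (i + 1) - u i‖ ^ 2) ≤ c * ρ ^ 2 * (1 / 8 : ℝ) ^ i :=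
      (mul_le_mul_of_nonneg_left h3 (by positivity)).trans (by simp only [hδ] at h1; linarith)
    have h5 : (1 / 8 : ℝ) ^ i = (1 / 2 : ℝ) ^ i * ((1 / 2 : ℝ) ^ i) ^ 2 := by
      rw [← pow_succ', ← pow_mul, mul_comm i, pow_mul]; norm_num
    rw [h5] at h4
    have h6 : ‖u (i + 1) - u i‖ ^ 2 ≤ (ρ * (1 / 2 : ℝ) ^ i) ^ 2 := by
      have hpos : 0 < (1 / 2 : ℝ) ^ i * c := by positivity
      refine le_of_mul_le_mul_left ?_ hpos
      calc _ = (1 / 2 : ℝ) ^ i * (c * ‖u (i + 1) - u i‖ ^ 2) := by ring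
        _ ≤ _ := h4
        _ = _ := by ring
    exact (sq_le_sq₀ (norm_nonneg _) (by positivity)).1 h6
  obtain ⟨x, hx⟩ := cauchySeq_tendsto_of_complete
    (cauchySeq_of_le_geometric _ _ (by norm_num) hdist)
  have hxd : ∀ i, ‖x - u i‖ ≤ 2 * ρ := by
    intro i
    have h1 := dist_le_of_le_geometric_of_tendsto _ _ (by norm_num) hdist hx i
    rw [dist_comm, dist_eq_norm] at h1
    have h2 : (1 / 2 : ℝ) ^ i ≤ 1 := pow_le_one₀ (by norm_num) (by norm_num)
    have h3 : ρ * (1 / 2 : ℝ) ^ i ≤ ρ := mul_le_of_le_one_right hρ.le h2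
    have h4 : ρ * (1 / 2 : ℝ) ^ i / (1 - 1 / 2) = 2 * (ρ * (1 / 2 : ℝ) ^ i) := by ring
    linarith
  have hxK : x ∈ K := hK.mem_of_tendsto hx (Eventually.of_forall huK)
  have hδ0 : Tendsto δ atTop (𝓝 0) := by
    have := (tendsto_pow_atTop_nhds_zero_of_lt_one (r := (1 / 8 : ℝ)) (by norm_num)
      (by norm_num)).const_mul (c * ρ ^ 2)
    simpa [hδ] using this
  -- Lower semicontinuity is applied with the penalty θ j frozen; as θ increases with the index, the
  -- bounds for i ≥ j still apply. Letting j tend to infinity comes later.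
  have hlim : ∀ (A : ℝ) (j : ℕ), (∀ i, φ (u i) + θ i (u i) ≤ A + δ i) → φ x + θ j x ≤ A := by
    intro A j hA
    have hl : LowerSemicontinuousOn (fun w => φ w + θ j w) K :=
      hφ.add ((hθc j).lowerSemicontinuous.lowerSemicontinuousOn K)
    refine le_of_forall_lt fun y hy => ?_
    have hev := (tendsto_nhdsWithin_iff.2 ⟨hx, Eventually.of_forall huK⟩).eventually
      (hl x hxK ((y + (φ x + θ j x)) / 2) (by simp only; linarith))
    have h1 : (y + (φ x + θ j x)) / 2 ≤ A := by
      have hA0 : Tendsto (fun i => A + δ i) atTop (𝓝 A) := by simpa using hδ0.const_add A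
      refine ge_of_tendsto hA0 ?_
      filter_upwards [hev, eventually_ge_atTop j] with i hi hij
      have := hθmono (u i) hij
      have := hA i
      linarith
    linarith
  have hup : ∀ z, h z ≤ L * ‖z‖ ^ 2 := le_mul_norm_sq_of_hasFDerivAt hL h0 hJ hd
  have hsum : ∀ w, Summable fun j => (1 / 2 : ℝ) ^ j * h (w - u j) := by
    intro w
    refine Summable.of_nonneg_of_le (fun j => hterm j w) (fun j => ?_)
      (summable_geometric_two.mul_right (L * (‖w - x‖ + 2 * ρ) ^ 2))
    refine mul_le_mul_of_nonneg_left ((hup _).trans ?_) (by positivity)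
    have : ‖w - u j‖ ≤ ‖w - x‖ + 2 * ρ := by
      calc ‖w - u j‖ = ‖(w - x) + (x - u j)‖ := by rw [sub_add_sub_cancel]
        _ ≤ _ := (norm_add_le _ _).trans (by linarith [hxd j])
    gcongr
  have hΘlim : ∀ w, Tendsto (fun i => θ i w) atTop
      (𝓝 (∑' j, (1 / 2 : ℝ) ^ j * h (w - u j))) := fun w => by
    simp only [hθsum]
    exact (hsum w).hasSum.tendsto_sum_nat
  have hΘge : ∀ i w, θ i w ≤ ∑' j, (1 / 2 : ℝ) ^ j * h (w - u j) := fun i w => by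
    rw [hθsum]; exact (hsum w).sum_le_tsum _ fun j _ => hterm j w
  refine ⟨x, hxK, fun w => ∑' j, (1 / 2 : ℝ) ^ j * h (w - u j),
    ∑' j, (1 / 2 : ℝ) ^ j • J (x - u j), ?_, ?_, ?_, fun w => tsum_nonneg fun j => hterm j w,
    ?_, fun w hw => ?_⟩
  · simpa [hu0] using hxd 0
  · refine hasFDerivAt_tsum_of_isPreconnected (s := Metric.ball x 1)
      (f := fun (j : ℕ) w => (1 / 2 : ℝ) ^ j * h (w - u j))
      (f' := fun (j : ℕ) w => (1 / 2 : ℝ) ^ j • J (w - u j))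
      (u := fun j => (1 / 2 : ℝ) ^ j * (L * (1 + 2 * ρ)))
      (summable_geometric_two.mul_right _) Metric.isOpen_ball
      (convex_ball x 1).isPreconnected (fun j w _ => ?_) (fun j w hw => ?_)
      (Metric.mem_ball_self one_pos) (hsum x) (Metric.mem_ball_self one_pos)
    · have h1 := (hd (w - u j)).comp w ((hasFDerivAt_id w).sub_const (u j))
      exact h1.const_mul _
    · rw [norm_smul, Real.norm_of_nonneg (by positivity)]
      refine mul_le_mul_of_nonneg_left ((hJ _).trans (mul_le_mul_of_nonneg_left ?_ hL))
        (by positivity)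
      rw [Metric.mem_ball, dist_eq_norm] at hw
      calc ‖w - u j‖ = ‖(w - x) + (x - u j)‖ := by rw [sub_add_sub_cancel]
        _ ≤ _ := (norm_add_le _ _).trans (by linarith [hxd j])
  · refine tsum_of_norm_bounded (g := fun j => (1 / 2 : ℝ) ^ j * (L * (2 * ρ))) ?_ fun j => ?_
    · rw [show 4 * L * ρ = 2 * (L * (2 * ρ)) by ring]
      exact hasSum_geometric_two.mul_right _
    · rw [norm_smul, Real.norm_of_nonneg (by positivity)]
      exact mul_le_mul_of_nonneg_left ((hJ _).trans (mul_le_mul_of_nonneg_left (hxd j) hL))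
        (by positivity)
  · refine le_of_tendsto ((hΘlim x).const_add (φ x)) (Eventually.of_forall fun j => ?_)
    exact hlim _ j fun i => (hdec0 i).trans (le_add_of_nonneg_right (hδpos i).le)
  · refine le_of_tendsto ((hΘlim x).const_add (φ x)) (Eventually.of_forall fun j => ?_)
    refine hlim _ j fun i => (halm i w hw).trans ?_
    have := hΘge i w
    linarith

end VariationalPrinciple

/-! ### The approximate sum rule -/

section SumRule

variable {V : Type*} [NormedAddCommGroup V] [NormedSpace ℝ V]

lemma neg_mem_frechetSubdiff {f : V → EReal} {ψ : V → ℝ} {ψ' : StrongDual ℝ V} {u : V} {b : ℝ}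
    (hbot : ∀ w, f w ≠ ⊥) (hb : f u = b) (hψ : HasFDerivAt ψ ψ' u)
    (hmin : ∀ᶠ w in 𝓝 u, ∀ b' : ℝ, f w = b' → b + ψ u ≤ b' + ψ w) :
    -ψ' ∈ frechetSubdiff f u := by
  refine ⟨by simp [hb], hbot u, fun ε hε => ?_⟩
  rw [hasFDerivAt_iff_isLittleO, Asymptotics.isLittleO_iff] at hψ
  filter_upwards [hmin, hψ hε] with w hw hψw
  by_cases htop : f w = ⊤
  · rw [htop]; exact le_top
  have hreal := EReal.coe_toReal htop (hbot w)
  have h1 := hw _ hreal.symm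
  have h2 := (Real.le_norm_self _).trans hψw
  rw [hb, ← hreal, ← EReal.coe_add, EReal.coe_le_coe_iff, neg_apply]
  linarith

/-- Since χ need not be convex, the inequality is first read on the segment from v to z: convexity
of g bounds the difference quotients of χ from below by g v - g z. -/
lemma neg_mem_convexSubdiff {g χ : V → ℝ} {χ' : StrongDual ℝ V} {v : V}
    (hg : ConvexOn ℝ univ g) (hχ : HasFDerivAt χ χ' v) (hmin : ∀ w, g v + χ v ≤ g w + χ w) :
    -χ' ∈ convexSubdiff g v := by
  intro z
  have hline : HasDerivAt (fun t : ℝ => χ (v + t • (z - v))) (χ' (z - v)) 0 := by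
    have h1 : HasDerivAt (fun t : ℝ => v + t • (z - v)) (z - v) 0 := by
      simpa using ((hasDerivAt_id (0 : ℝ)).smul_const (z - v)).const_add v
    have h2 : HasFDerivAt χ χ' (v + (0 : ℝ) • (z - v)) := by simpa using hχ
    exact h2.comp_hasDerivAt 0 h1
  have hlim := hline.tendsto_slope_zero_right
  have key : g v - g z ≤ χ' (z - v) := by
    refine ge_of_tendsto hlim ?_
    filter_upwards [Ioo_mem_nhdsGT (zero_lt_one (α := ℝ))] with t ht
    have h1 := hmin (v + t • (z - v))
    have h2 := hg.2 (mem_univ v) (mem_univ z) (sub_nonneg.2 ht.2.le) ht.1.le (sub_add_cancel 1 t)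
    have h3 : (1 - t) • v + t • z = v + t • (z - v) := by module
    rw [h3, smul_eq_mul, smul_eq_mul] at h2
    simp only [zero_add, zero_smul, add_zero, smul_eq_mul]
    rw [le_inv_mul_iff₀ ht.1]
    linarith
  rw [neg_apply]
  linarith

lemma lowerSemicontinuousOn_toReal {X : Type*} [TopologicalSpace X] {f : X → EReal}
    (hf : LowerSemicontinuous f) {K : Set X} (hbot : ∀ x ∈ K, f x ≠ ⊥) (htop : ∀ x ∈ K, f x ≠ ⊤) :
    LowerSemicontinuousOn (fun x => (f x).toReal) K := by
  intro x hx y hy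
  have h1 : (y : EReal) < f x := by
    rw [← EReal.coe_toReal (htop x hx) (hbot x hx)]; exact EReal.coe_lt_coe_iff.2 hy
  filter_upwards [(hf x y h1).filter_mono nhdsWithin_le_nhds, self_mem_nhdsWithin] with w hw hwK
  rw [← EReal.coe_toReal (htop w hwK) (hbot w hwK)] at hw
  exact EReal.coe_lt_coe_iff.1 hw

/-- Approximate sum rule: near a minimizer of `f + g`, with `g` convex and locally Lipschitz, there
are almost opposite Fréchet subgradients of `f` and subgradients of `g`. -/
theorem exists_approximate_subgradients [CompleteSpace V] {h : V → ℝ} {J : V → StrongDual ℝ V}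
    (h0 : h 0 = 0) (hlow : ∀ x, ‖x‖ ^ 2 / 16 ≤ h x) (hJ : ∀ x, ‖J x‖ ≤ ‖x‖)
    (hd : ∀ x, HasFDerivAt h (J x) x) {f : V → EReal} {g : V → ℝ}
    (hf : LowerSemicontinuous f) (hf0 : ∀ u, 0 ≤ f u) (hg : ConvexOn ℝ univ g)
    (hgc : Continuous g) (hg0 : ∀ u, 0 ≤ g u) {ubar : V} {r L a : ℝ} (hr : 0 < r)
    (hLip : ∀ u ∈ Metric.closedBall ubar r, ∀ v ∈ Metric.closedBall ubar r,
      g u - g v ≤ L * ‖u - v‖)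
    (ha : f ubar = a) (hmin : ∀ (u : V) (b : ℝ), f u = b → a + g ubar ≤ b + g u)
    {δ : ℝ} (hδ : 0 < δ) :
    ∃ (u v : V) (ξ η : StrongDual ℝ V) (b : ℝ), f u = b ∧ ‖u - ubar‖ ≤ δ ∧ ‖v - ubar‖ ≤ δ ∧
      ξ ∈ frechetSubdiff f u ∧ η ∈ convexSubdiff g v ∧ ‖ξ + η‖ ≤ δ ∧ b + g v ≤ a + g ubar := by
  have hbot : ∀ u, f u ≠ ⊥ := fun u hu => by simpa [hu] using hf0 u
  have ha0 : 0 ≤ a := by have := hf0 ubar; rw [ha] at this; exact_mod_cast this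
  obtain ⟨m, hm⟩ : ∃ m, m = a + g ubar := ⟨_, rfl⟩
  have hm0 : 0 ≤ m := hm ▸ add_nonneg ha0 (hg0 _)
  -- The two components of Λ have total norm at most 16ρ ≤ δ, and 3ρ ≤ r/2 keeps a ρ-neighbourhood
  -- of u inside the ball defining K.
  let ρ : ℝ := min (δ / 16) (r / 8)
  have hρ : 0 < ρ := lt_min (by positivity) (by positivity)
  have hρδ : ρ ≤ δ / 16 := min_le_left _ _
  have hρr : ρ ≤ r / 8 := min_le_right _ _
  clear_value ρ
  -- The first summand absorbs the Lipschitz error L‖p.1 - p.2‖ when the two points are close; the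
  -- second makes the penalty exceed m when they are more than r/2 apart.
  let N : ℝ := 64 * L ^ 2 / ρ ^ 2 + 64 * m / r ^ 2
  have hN0 : 0 ≤ N := by positivity
  have hN1 : 64 * L ^ 2 ≤ N * ρ ^ 2 := by
    have h1 : 64 * L ^ 2 / ρ ^ 2 ≤ N := le_add_of_nonneg_right (by positivity)
    rwa [div_le_iff₀ (by positivity)] at h1
  have hN2 : 64 * m ≤ N * r ^ 2 := by
    have h1 : 64 * m / r ^ 2 ≤ N := le_add_of_nonneg_left (by positivity)
    rwa [div_le_iff₀ (by positivity)] at h1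
  clear_value N
  -- The bound f ≤ m keeps f finite on K. The second variable is free, so that minimality in it is
  -- global, as a convex subgradient demands.
  let K : Set (V × V) := {p | p.1 ∈ Metric.closedBall ubar (r / 2) ∧ f p.1 ≤ (m : EReal)}
  have hK : IsClosed K := (Metric.isClosed_closedBall.preimage continuous_fst).inter
    ((hf.isClosed_preimage _).preimage continuous_fst)
  have hKtop : ∀ p ∈ K, f p.1 ≠ ⊤ := fun p hp htop => by
    have := hp.2
    rw [htop, top_le_iff] at this
    exact EReal.coe_ne_top _ this
  have hF0 : ∀ u, 0 ≤ (f u).toReal := fun u => EReal.toReal_nonneg (hf0 u)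
  have hhc : Continuous h := continuous_iff_continuousAt.2 fun x => (hd x).continuousAt
  let φ : V × V → ℝ := fun p => (f p.1).toReal + (g p.2 + N * h (p.1 - p.2))
  have hφ : LowerSemicontinuousOn φ K := by
    refine (lowerSemicontinuousOn_toReal (f := fun p : V × V => f p.1)
      (hf.comp continuous_fst) (fun p _ => hbot _) hKtop).add ?_
    have : Continuous fun p : V × V => g p.2 + N * h (p.1 - p.2) := by fun_prop
    exact this.lowerSemicontinuous.lowerSemicontinuousOn K
  have hx₀ : ((ubar, ubar) : V × V) ∈ K := by
    refine ⟨Metric.mem_closedBall_self (by positivity), ?_⟩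
    rw [ha, EReal.coe_le_coe_iff, hm]
    exact le_add_of_nonneg_right (hg0 _)
  have hφ₀ : φ (ubar, ubar) = m := by simp [φ, ha, h0, hm]
  have halm : ∀ p ∈ K, φ (ubar, ubar) ≤ φ p + 1 / 16 * ρ ^ 2 := by
    intro p hp
    rw [hφ₀]
    have h1 := hlow (p.1 - p.2)
    have h2 := mul_le_mul_of_nonneg_left h1 hN0
    have h3 := hF0 p.1
    have h4 := hg0 p.2
    show m ≤ (f p.1).toReal + (g p.2 + N * h (p.1 - p.2)) + 1 / 16 * ρ ^ 2
    rcases le_or_gt ‖p.1 - p.2‖ (r / 2) with hd' | hd'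
    · have hp1 : p.1 ∈ Metric.closedBall ubar r :=
        Metric.closedBall_subset_closedBall (by linarith) hp.1
      have hp2 : p.2 ∈ Metric.closedBall ubar r := by
        have h5 := hp.1
        rw [Metric.mem_closedBall] at h5 ⊢
        have h6 := dist_triangle_left p.2 ubar p.1
        rw [dist_eq_norm p.1 p.2] at h6
        linarith
      have h5 := hLip _ hp1 _ hp2
      have h6 := hmin p.1 _ (EReal.coe_toReal (hKtop p hp) (hbot _)).symm
      rw [← hm] at h6
      have h7 : L * ‖p.1 - p.2‖ ≤ N * (‖p.1 - p.2‖ ^ 2 / 16) + 1 / 16 * ρ ^ 2 := by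
        set d := ‖p.1 - p.2‖
        have h8 : 64 * L ^ 2 * d ^ 2 ≤ N * ρ ^ 2 * d ^ 2 :=
          mul_le_mul_of_nonneg_right hN1 (sq_nonneg _)
        have h9 : 0 ≤ (8 * (L * d) - ρ ^ 2) ^ 2 := sq_nonneg _
        have h10 : 0 < ρ ^ 2 := by positivity
        have h11 : ρ ^ 2 * (L * d) ≤ ρ ^ 2 * (N * (d ^ 2 / 16) + 1 / 16 * ρ ^ 2) := by
          linarith
        exact le_of_mul_le_mul_left h11 h10
      linarith
    · have h5 : (r / 2) ^ 2 ≤ ‖p.1 - p.2‖ ^ 2 := pow_le_pow_left₀ (by positivity) hd'.le 2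
      have h6 := mul_le_mul_of_nonneg_left h5 hN0
      have h7 : 0 ≤ ρ ^ 2 := sq_nonneg _
      linarith
  let fstL : V × V →L[ℝ] V := ContinuousLinearMap.fst ℝ V V
  let sndL : V × V →L[ℝ] V := ContinuousLinearMap.snd ℝ V V
  obtain ⟨p, hpK, Θ, Λ, hp, hΘ, hΛ, hΘ0, hval, hpmin⟩ := smooth_variational_principle
    (h := fun p : V × V => h p.1 + h p.2) (J := fun p => (J p.1).comp fstL + (J p.2).comp sndL)
    (c := 1 / 16) (L := 2) (by norm_num) (by norm_num) hρ (by simp [h0])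
    (fun x => by
      have h1 := hlow x.1
      have h2 := hlow x.2
      have h3 := sq_nonneg ‖x.1‖
      have h4 := sq_nonneg ‖x.2‖
      rw [Prod.norm_def]
      rcases max_cases ‖x.1‖ ‖x.2‖ with ⟨h, -⟩ | ⟨h, -⟩ <;> rw [h] <;> linarith)
    (fun x => by
      have h1 : ‖(J x.1).comp fstL‖ ≤ ‖x‖ := by
        refine ((J x.1).opNorm_comp_le fstL).trans ?_
        refine (mul_le_of_le_one_right (norm_nonneg _)
          (ContinuousLinearMap.norm_fst_le ℝ V V)).trans ((hJ _).trans (norm_fst_le x))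
      have h2 : ‖(J x.2).comp sndL‖ ≤ ‖x‖ := by
        refine ((J x.2).opNorm_comp_le sndL).trans ?_
        refine (mul_le_of_le_one_right (norm_nonneg _)
          (ContinuousLinearMap.norm_snd_le ℝ V V)).trans ((hJ _).trans (norm_snd_le x))
      have h3 := norm_add_le ((J x.1).comp fstL) ((J x.2).comp sndL)
      linarith)
    (fun x => ((hd x.1).comp x hasFDerivAt_fst).add ((hd x.2).comp x hasFDerivAt_snd))
    hK hφ hx₀ halm
  obtain ⟨u, v⟩ := p
  have hu : ‖u - ubar‖ ≤ 2 * ρ := (norm_fst_le ((u, v) - (ubar, ubar))).trans hp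
  have hv : ‖v - ubar‖ ≤ 2 * ρ := (norm_snd_le ((u, v) - (ubar, ubar))).trans hp
  rw [hφ₀] at hval
  have hub : f u = ((f u).toReal : EReal) := (EReal.coe_toReal (hKtop _ hpK) (hbot _)).symm
  let inlL : V →L[ℝ] V × V := ContinuousLinearMap.inl ℝ V V
  let inrL : V →L[ℝ] V × V := ContinuousLinearMap.inr ℝ V V
  have hψ : HasFDerivAt (fun w => N * h (w - v) + Θ (w, v))
      (N • J (u - v) + Λ.comp inlL) u := by
    have h1 := ((hd (u - v)).comp u ((hasFDerivAt_id u).sub_const v)).const_mul N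
    have h2 := HasFDerivAt.comp (g := Θ) (f := fun w => (w, v)) u hΘ (hasFDerivAt_prodMk_left u v)
    exact h1.add h2
  have hχ : HasFDerivAt (fun w => N * h (u - w) + Θ (u, w))
      (-(N • J (u - v)) + Λ.comp inrL) v := by
    have h1 := ((hd (u - v)).comp v ((hasFDerivAt_id v).const_sub u)).const_mul N
    have h2 := HasFDerivAt.comp (g := Θ) (f := fun w => (u, w)) v hΘ (hasFDerivAt_prodMk_right u v)
    have h3 := h1.add h2
    have h4 : N • (J (u - v)).comp (-ContinuousLinearMap.id ℝ V) = -(N • J (u - v)) := by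
      ext z; simp
    rw [h4] at h3
    exact h3
  have hN0h : 0 ≤ N * h (u - v) := mul_nonneg hN0 (le_trans (by positivity) (hlow _))
  refine ⟨u, v, _, _, (f u).toReal, hub, by linarith, by linarith,
    neg_mem_frechetSubdiff hbot hub hψ ?_, neg_mem_convexSubdiff hg hχ fun w => ?_, ?_, ?_⟩
  · have hball : Metric.ball u ρ ∈ 𝓝 u := Metric.ball_mem_nhds u hρ
    filter_upwards [hball] with w hw b' hb'
    have hwK : w ∈ Metric.closedBall ubar (r / 2) := by
      rw [Metric.mem_ball] at hw
      rw [Metric.mem_closedBall]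
      have h1 := dist_triangle w u ubar
      rw [dist_eq_norm u ubar] at h1
      linarith
    rcases le_or_gt b' m with hle | hgt
    · have h1 := hpmin (w, v) ⟨hwK, by rw [hb']; exact_mod_cast hle⟩
      simp only [φ, hb', EReal.toReal_coe] at h1
      linarith
    -- Points excluded from K by f > m cannot compete, since the minimal perturbed value is at most
    -- m.
    · have h1 := hΘ0 (w, v)
      have h2 : 0 ≤ N * h (w - v) := mul_nonneg hN0 (le_trans (by positivity) (hlow _))
      simp only [φ] at hval
      have h3 := hg0 v
      linarith
  · have h1 := hpmin (u, w) hpK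
    simp only [φ] at h1
    linarith
  -- The large penalty terms cancel, so the size of N is irrelevant to the bound.
  · have h1 : -(N • J (u - v) + Λ.comp inlL) + -(-(N • J (u - v)) + Λ.comp inrL) =
        -(Λ.comp inlL + Λ.comp inrL) := by abel
    rw [h1, norm_neg]
    have h2 : ‖Λ.comp inlL‖ ≤ ‖Λ‖ := (Λ.opNorm_comp_le inlL).trans
      (mul_le_of_le_one_right (norm_nonneg _) (ContinuousLinearMap.norm_inl_le_one ℝ V V))
    have h3 : ‖Λ.comp inrL‖ ≤ ‖Λ‖ := (Λ.opNorm_comp_le inrL).trans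
      (mul_le_of_le_one_right (norm_nonneg _) (ContinuousLinearMap.norm_inr_le_one ℝ V V))
    have h4 := norm_add_le (Λ.comp inlL) (Λ.comp inrL)
    linarith
  · have h1 := hΘ0 (u, v)
    simp only [φ] at hval
    linarith

end SumRule

/-! ### Passage to the limit -/

section Limit

variable {V : Type*} [NormedAddCommGroup V] [NormedSpace ℝ V]

/-- A finite lower semicontinuous convex function on a Banach space is locally Lipschitz. -/
lemma locallyLipschitz_of_convexOn_of_lowerSemicontinuous [CompleteSpace V] {g : V → ℝ}
    (hg : ConvexOn ℝ univ g) (hl : LowerSemicontinuous g) : LocallyLipschitz g := by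
  -- By Baire some closed sublevel set has interior; for a convex function, boundedness above near
  -- one point gives local Lipschitz continuity everywhere.
  obtain ⟨n, x, hx⟩ := nonempty_interior_of_iUnion_of_closed (f := fun n : ℕ => g ⁻¹' Iic (n : ℝ))
    (fun n => hl.isClosed_preimage _) (by
      refine eq_univ_of_forall fun x => mem_iUnion.2 ?_
      obtain ⟨n, hn⟩ := exists_nat_ge (g x)
      exact ⟨n, hn⟩)
  have hbdd : ∃ x₀ ∈ (univ : Set V), (𝓝 x₀).IsBoundedUnder (· ≤ ·) g :=
    ⟨x, mem_univ x, n, by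
      rw [eventually_map]
      exact mem_of_superset (mem_interior_iff_mem_nhds.1 hx) fun w hw => hw⟩
  exact locallyLipschitzOn_univ.1 (((hg.continuousOn_tfae isOpen_univ ⟨x, mem_univ x⟩).out 3 0).1 hbdd)

lemma norm_le_of_mem_convexSubdiff {g : V → ℝ} {x v : V} {r L : ℝ} (hL : 0 ≤ L)
    (hLip : ∀ u ∈ Metric.closedBall x r, ∀ v ∈ Metric.closedBall x r, g u - g v ≤ L * ‖u - v‖)
    (hv : ‖v - x‖ < r) {η : StrongDual ℝ V} (hη : η ∈ convexSubdiff g v) : ‖η‖ ≤ L := by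
  refine ContinuousLinearMap.opNorm_le_of_ball (sub_pos.2 hv) hL fun z hz => ?_
  rw [mem_ball_zero_iff] at hz
  have hvm : v ∈ Metric.closedBall x r := by rw [mem_closedBall_iff_norm]; exact hv.le
  have aux : ∀ w : V, ‖w‖ = ‖z‖ → η w ≤ L * ‖z‖ := by
    intro w hw
    have hm : v + w ∈ Metric.closedBall x r := by
      rw [mem_closedBall_iff_norm, add_sub_right_comm]
      exact (norm_add_le _ _).trans (by linarith)
    have h1 := hη (v + w)
    have h2 := hLip _ hm _ hvm
    rw [add_sub_cancel_left] at h1 h2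
    rw [hw] at h2
    linarith
  rw [Real.norm_eq_abs, abs_le']
  exact ⟨aux z rfl, by simpa using aux (-z) (norm_neg z)⟩

/-- By reflexivity every functional on the dual is an evaluation, so pointwise convergence is
already weak convergence. -/
lemma tendsto_toWeakSpace_of_reflexive (hV : IsReflexiveSpace V) {ξs : ℕ → StrongDual ℝ V}
    {ξ : StrongDual ℝ V} (h : ∀ v, Tendsto (fun n => ξs n v) atTop (𝓝 (ξ v))) :
    Tendsto (fun n => toWeakSpace ℝ (StrongDual ℝ V) (ξs n)) atTop
      (𝓝 (toWeakSpace ℝ (StrongDual ℝ V) ξ)) := by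
  refine (WeakBilin.tendsto_iff_forall_eval_tendsto _ (f := fun n =>
    toWeakSpace ℝ (StrongDual ℝ V) (ξs n)) (x := toWeakSpace ℝ (StrongDual ℝ V) ξ) ?_).2 ?_
  · intro ξ₁ ξ₂ h12
    ext v
    exact congrArg (fun B => B (NormedSpace.inclusionInDoubleDual ℝ V v)) h12
  · intro Φ
    obtain ⟨v, rfl⟩ := hV Φ
    exact h v

/-- Bounded sequences in the dual of a separable space have pointwise convergent subsequences. -/
lemma exists_subseq_tendsto_apply [TopologicalSpace.SeparableSpace V] {ξs : ℕ → StrongDual ℝ V}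
    {R : ℝ} (hR : ∀ n, ‖ξs n‖ ≤ R) :
    ∃ (ξ : StrongDual ℝ V) (φ : ℕ → ℕ), StrictMono φ ∧
      ∀ v, Tendsto (fun n => ξs (φ n) v) atTop (𝓝 (ξ v)) := by
  obtain ⟨ξ, -, φ, hφ, hlim⟩ := WeakDual.isSeqCompact_closedBall ℝ V 0 R
    (x := fun n => StrongDual.toWeakDual (ξs n)) (fun n => by simpa using hR n)
  exact ⟨WeakDual.toStrongDual ξ, φ, hφ, fun v =>
    ((WeakDual.eval_continuous v).tendsto ξ).comp hlim⟩

/-- Exact sum rule at a minimizer of `f + g`: a weak limit of Fréchet subgradients of `f` along a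
sequence converging in energy is opposite to a subgradient of `g`. -/
theorem exists_limiting_subgradient [CompleteSpace V] [TopologicalSpace.SeparableSpace V]
    (hV : IsReflexiveSpace V) {f : V → EReal} {g : V → ℝ}
    (hf : LowerSemicontinuous f) (hf0 : ∀ u, 0 ≤ f u) (hg : ConvexOn ℝ univ g)
    (hgl : LowerSemicontinuous g) (hg0 : ∀ u, 0 ≤ g u) {ubar : V} {a : ℝ}
    (ha : f ubar = a) (hmin : ∀ (u : V) (b : ℝ), f u = b → a + g ubar ≤ b + g u) :
    ∃ (us : ℕ → V) (ξs : ℕ → StrongDual ℝ V) (es : ℕ → ℝ) (ξ : StrongDual ℝ V),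
      (∀ n, f (us n) = es n) ∧ (∀ n, ξs n ∈ frechetSubdiff f (us n)) ∧
      Tendsto us atTop (𝓝 ubar) ∧
      Tendsto (fun n => toWeakSpace ℝ (StrongDual ℝ V) (ξs n)) atTop
        (𝓝 (toWeakSpace ℝ (StrongDual ℝ V) ξ)) ∧
      Tendsto es atTop (𝓝 a) ∧ -ξ ∈ convexSubdiff g ubar := by
  obtain ⟨h, J, h0, hlow, hJ, hd⟩ := exists_smooth_quadratic hV
  have hLL := locallyLipschitz_of_convexOn_of_lowerSemicontinuous hg hgl
  have hgc : Continuous g := hLL.continuous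
  obtain ⟨L, t, ht, hL⟩ := hLL ubar
  obtain ⟨r, hr, hrt⟩ := Metric.nhds_basis_closedBall.mem_iff.1 ht
  have hLip : ∀ u ∈ Metric.closedBall ubar r, ∀ v ∈ Metric.closedBall ubar r,
      g u - g v ≤ L * ‖u - v‖ := fun u hu v hv => by
    rw [← dist_eq_norm]
    exact (le_abs_self _).trans (hL.dist_le_mul u (hrt hu) v (hrt hv))
  obtain ⟨δ, -, hδ, hδ0⟩ := exists_seq_strictAnti_tendsto' hr
  choose us vs ξs ηs es hes hus hvs hξs hηs hsum hval using fun n =>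
    exists_approximate_subgradients h0 hlow hJ hd hf hf0 hg hgc hg0 hr hLip ha hmin (hδ n).1
  have hηb : ∀ n, ‖ηs n‖ ≤ L := fun n =>
    norm_le_of_mem_convexSubdiff L.2 hLip ((hvs n).trans_lt (hδ n).2) (hηs n)
  have hξb : ∀ n, ‖ξs n‖ ≤ r + L := fun n => by
    calc ‖ξs n‖ = ‖(ξs n + ηs n) - ηs n‖ := by rw [add_sub_cancel_right]
      _ ≤ ‖ξs n + ηs n‖ + ‖ηs n‖ := norm_sub_le _ _
      _ ≤ r + L := add_le_add ((hsum n).trans (hδ n).2.le) (hηb n)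
  have husl : Tendsto us atTop (𝓝 ubar) :=
    tendsto_iff_norm_sub_tendsto_zero.2 (squeeze_zero (fun _ => norm_nonneg _) hus hδ0)
  have hvsl : Tendsto vs atTop (𝓝 ubar) :=
    tendsto_iff_norm_sub_tendsto_zero.2 (squeeze_zero (fun _ => norm_nonneg _) hvs hδ0)
  have hsl : Tendsto (fun n => ξs n + ηs n) atTop (𝓝 0) :=
    squeeze_zero_norm hsum hδ0
  have hgl' : Tendsto (fun n => g (vs n)) atTop (𝓝 (g ubar)) := (hgc.tendsto _).comp hvsl
  have hesl : Tendsto es atTop (𝓝 a) := by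
    refine tendsto_order.2 ⟨fun b hb => ?_, fun b hb => ?_⟩
    · have hlt : (b : EReal) < f ubar := by rw [ha]; exact_mod_cast hb
      filter_upwards [husl.eventually (hf ubar b hlt)] with n hn
      rw [hes] at hn
      exact_mod_cast hn
    · have h1 : Tendsto (fun n => a + g ubar - g (vs n)) atTop (𝓝 a) := by
        simpa using hgl'.const_sub (a + g ubar)
      filter_upwards [h1.eventually_lt_const hb] with n hn
      linarith [hval n]
  obtain ⟨ξ, φ, hφ, hξl⟩ := exists_subseq_tendsto_apply hξb
  have hφt := hφ.tendsto_atTop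
  refine ⟨us ∘ φ, ξs ∘ φ, es ∘ φ, ξ, fun n => hes _, fun n => hξs _, husl.comp hφt,
    tendsto_toWeakSpace_of_reflexive hV hξl, hesl.comp hφt, fun z => ?_⟩
  have h1 : Tendsto (fun n => ξs (φ n) (z - ubar)) atTop (𝓝 (ξ (z - ubar))) := hξl _
  have h2 : Tendsto (fun n => (ξs (φ n) + ηs (φ n)) (z - ubar)) atTop (𝓝 0) := by
    have := ((ContinuousLinearMap.apply ℝ ℝ (z - ubar)).continuous.tendsto 0).comp (hsl.comp hφt)
    rwa [map_zero] at this
  have h3 : Tendsto (fun n => ηs (φ n) (vs (φ n) - ubar)) atTop (𝓝 0) := by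
    refine squeeze_zero_norm (a := fun n => L * δ (φ n)) (fun n => ?_) ?_
    · exact ((ηs (φ n)).le_opNorm _).trans
        (mul_le_mul (hηb _) (hvs _) (norm_nonneg _) L.2)
    · simpa using (hδ0.comp hφt).const_mul (L : ℝ)
  -- This rests on η(z - v) = (ξ + η)(z - ubar) - ξ(z - ubar) - η(v - ubar), whose first and last
  -- terms vanish in the limit.
  have h4 := ((hgl'.comp hφt).add ((h2.sub h1).sub h3))
  rw [zero_sub, sub_zero, ← neg_apply] at h4
  refine le_of_tendsto h4 (Eventually.of_forall fun n => ?_)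
  have h5 := hηs (φ n) z
  simp only [Function.comp, add_apply, map_sub] at h5 ⊢
  linarith

end Limit

/-! ### The variational sum rule -/

theorem proposition4 {V : Type*} [NormedAddCommGroup V] [NormedSpace ℝ V] [CompleteSpace V]
    [TopologicalSpace.SeparableSpace V] (hV : IsReflexiveSpace V)
    (T : ℝ) (D : Set V) (E : ℝ → V → EReal) (F : ℝ → V → Set (StrongDual ℝ V))
    (S : Set V) (Ψ : V → V → ℝ)
    (hΨ : ∀ w ∈ S, IsAdmissiblePotential (Ψ w))
    (hE : IsEnergy T D E F)
    (hsub : ∀ t ∈ Set.Icc 0 T, ∀ u ∈ D, frechetSubdiff (E t) u ⊆ F t u)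
    (hclosed : IsWeaklyClosedPair T D E F) :
    ∀ t ∈ Set.Icc 0 T, ∀ u₀ ∈ S, ∀ τ : ℝ, 0 < τ → ∀ ubar : V,
      IsMinOn (fun u => E t u + ((τ * Ψ u₀ (τ⁻¹ • (u - u₀)) : ℝ) : EReal)) Set.univ ubar →
      ∃ ξ ∈ F t ubar, -ξ ∈ convexSubdiff (Ψ u₀) (τ⁻¹ • (ubar - u₀)) := by
  intro t ht u₀ hu₀ τ hτ ubar hubar
  obtain ⟨C₀, hC₀, hlow⟩ := hE.bounded_below
  have hP := hΨ u₀ hu₀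
  have hE0 : ∀ u, 0 ≤ E t u := fun u => by
    by_cases hu : u ∈ D
    · exact (EReal.coe_nonneg.2 hC₀.le).trans (hlow t ht u hu)
    · have : E t u = ⊤ := by
        by_contra hne
        exact hu ((hE.dom_eq t ht u).1 hne)
      rw [this]; exact le_top
  have hbot : ∀ u, E t u ≠ ⊥ := fun u hu => by simpa [hu] using hE0 u
  let g : V → ℝ := fun u => τ * Ψ u₀ (τ⁻¹ • (u - u₀))
  have hcont : Continuous fun u : V => τ⁻¹ • (u - u₀) := by fun_prop
  have hgl : LowerSemicontinuous g :=
    (continuous_const_mul τ).comp_lowerSemicontinuous (hP.lsc.comp hcont)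
      fun _ _ h => mul_le_mul_of_nonneg_left h hτ.le
  have hg : ConvexOn ℝ univ g := by
    refine ⟨convex_univ, fun x _ y _ a b ha hb hab => ?_⟩
    have h1 := hP.convex.2 (mem_univ (τ⁻¹ • (x - u₀))) (mem_univ (τ⁻¹ • (y - u₀))) ha hb hab
    have h2 : a • τ⁻¹ • (x - u₀) + b • τ⁻¹ • (y - u₀) = τ⁻¹ • (a • x + b • y - u₀) := by
      obtain rfl : b = 1 - a := by linarith
      module
    rw [h2] at h1
    have h3 := mul_le_mul_of_nonneg_left h1 hτ.le
    simp only [g, smul_eq_mul] at h3 ⊢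
    linarith
  have hg0 : ∀ u, 0 ≤ g u := fun u => mul_nonneg hτ.le (hP.nonneg _)
  have hminE : ∀ u, E t ubar + (g ubar : EReal) ≤ E t u + (g u : EReal) := fun u =>
    hubar (mem_univ u)
  have htop : E t ubar ≠ ⊤ := by
    obtain ⟨w, hw⟩ := hE.dom_nonempty
    intro hcon
    have h1 := hminE w
    rw [hcon, EReal.top_add_coe, top_le_iff,
      ← EReal.coe_toReal ((hE.dom_eq t ht w).2 hw) (hbot w), ← EReal.coe_add] at h1
    exact EReal.coe_ne_top _ h1
  have ha := (EReal.coe_toReal htop (hbot ubar)).symm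
  obtain ⟨us, ξs, es, ξ, hes, hξs, hus, hξ, hesl, hsubg⟩ :=
    exists_limiting_subgradient hV (hE.lsc t ht) hE0 hg hgl hg0 ha (fun u b hb => by
      have h1 := hminE u
      rw [hb, ha, ← EReal.coe_add, ← EReal.coe_add, EReal.coe_le_coe_iff] at h1
      exact h1)
  have hD : ∀ n, us n ∈ D := fun n => (hE.dom_eq t ht _).1 (by rw [hes]; exact EReal.coe_ne_top _)
  obtain ⟨-, hmem, -⟩ := hclosed t ht us ξs es ubar ξ _
    (fun n => ⟨ht, hD n, hsub t ht _ (hD n) (hξs n)⟩) (fun n => (hes n).symm) hus hξ hesl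
  refine ⟨ξ, hmem, fun z => ?_⟩
  -- This test point turns the rescaled argument of Ψ into z, and the common factor τ then cancels.
  have h1 := hsubg (u₀ + τ • z)
  have h2 : u₀ + τ • z - ubar = τ • (z - τ⁻¹ • (ubar - u₀)) := by
    rw [smul_sub, smul_inv_smul₀ hτ.ne']; abel
  have h3 : τ⁻¹ • (u₀ + τ • z - u₀) = z := by
    rw [add_sub_cancel_left, inv_smul_smul₀ hτ.ne']
  simp only [g] at h1
  rw [h2, h3, map_smul, smul_eq_mul, ← mul_add] at h1
  exact le_of_mul_le_mul_left h1 hτ
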